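/- Let $\mathcal{C}$ be a compactly generated triangulated category, that is, a triangulated category which has arbitrary (set-indexed) direct sums, such that every nonzero object $B$ of $\mathcal{C}$ admits a nonzero morphism $C\to B$ from a compact object $C$, and such that the isomorphism classes of compact objects form a set. Here an object $C$ is compact if every morphism $C\to\bigoplus_{i\in I}X_i$ factors through the canonical morphism $\bigoplus_{i\in F}X_i\to\bigoplus_{i\in I}X_i$ for some finite subset $F\subseteq I$. A nonzero object is called indecomposable if it is not isomorphic to a direct sum of two nonzero objects. Let $(A_i)_{i\in I}$ be a family of objects of $\mathcal{C}$, indexed by a set $I$, such that every endomorphism ring $\mathrm{End}(A_i)$ is local. Then: (a) If $B$ is an indecomposable direct summand of $\bigoplus_{i\in I}A_i$, then there exists $i\in I$ such that $B\cong A_i$. (b) If $(B_j)_{j\in J}$ is a family of indecomposable objects of $\mathcal{C}$, indexed by a set $J$, such that $\bigoplus_{i\in I}A_i\cong\bigoplus_{j\in J}B_j$, then there exists a bijection $\sigma:I\to J$ such that $A_i\cong B_{\sigma(i)}$ for every $i\in I$. -/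

import Mathlib

open CategoryTheory CategoryTheory.Limits

universe w v u

namespace KRSA

variable {C : Type u} [Category.{v} C]

/-- The canonical morphism `X(J) ⟶ X` from the partial direct sum indexed by a finite subset
`J ⊆ I` to the direct sum `X = ⨁_{i ∈ I} A i`. -/
noncomputable def partialSum [HasCoproducts.{w} C] {I : Type w} (A : I → C) (J : Finset I) :
    (∐ fun j : J => A j) ⟶ ∐ A :=
  Sigma.desc fun j : J => Sigma.ι A j

/-- An object `X` is compact if every morphism from `X` to a direct sum (indexed by a `w`-small
set) factors through a finite partial direct sum. -/
def IsCompactObject [HasCoproducts.{w} C] (X : C) : Prop :=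
  ∀ (I : Type w) (A : I → C) (f : X ⟶ ∐ A),
    ∃ (J : Finset I) (g : X ⟶ ∐ fun j : J => A j), g ≫ partialSum A J = f

/-- The property of objects of being compact. -/
def compactObjects (C : Type u) [Category.{v} C] [HasCoproducts.{w} C] : ObjectProperty C :=
  fun X => IsCompactObject.{w} X

/-- There are enough compact objects: every nonzero object receives a nonzero morphism from a
compact object. -/
def HasEnoughCompacts (C : Type u) [Category.{v} C] [HasZeroMorphisms C]
    [HasCoproducts.{w} C] : Prop :=
  ∀ B : C, ¬ IsZero B → ∃ (X : C) (f : X ⟶ B), IsCompactObject.{w} X ∧ f ≠ 0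

/-- For a (triangulated) category with direct sums, being compactly generated means that there are
enough compact objects and that the isomorphism classes of compact objects form a set. -/
structure IsCompactlyGenerated (C : Type u) [Category.{v} C] [HasZeroMorphisms C]
    [HasCoproducts.{w} C] : Prop where
  enough : HasEnoughCompacts.{w} C
  essentiallySmall : ObjectProperty.EssentiallySmall.{w} (compactObjects.{w} C)

/-- `B` is a direct summand of `X`: there is a decomposition `X ≅ B ⊕ B'`. -/
def IsDirectSummand [HasZeroMorphisms C] [HasBinaryBiproducts C] (B X : C) : Prop :=
  ∃ B' : C, Nonempty (X ≅ B ⊞ B')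

end KRSA

/-!
The crux of (a) is that the indecomposable summand `B` contains some `A i` as a retract. If none is,
every composite `B ⟶ A i ⟶ B` lies in the Jacobson radical of `End B`, and so do finite sums of
these. By compactness, the identity of `B` agrees with such a sum after precomposition with a
nonzero morphism `K ⟶ B` from a compact object, although `1 - s` is invertible for `s` in the
radical.

By (a), each `B j` in (b) is isomorphic to some `A i`, so both families have local
endomorphism rings.
Fix `X` with local endomorphism ring. The morphisms `X ⟶ ∐ A` modulo those that are not split
monomorphisms form a vector space over the residue division ring of `X`. Compactness again makes
every morphism a finite sum of its components in this quotient, where the components through some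
`A i` not isomorphic to `X` vanish. So the inclusions of the summands isomorphic to `X` give a
basis, and their number depends only on `∐ A`.
-/

namespace KRSA

section LocalRing

variable {R : Type*} [Ring R]

theorem mem_ringJacobson_iff {x : R} :
    x ∈ Ring.jacobson R ↔ ∀ y, ∃ z, z * (1 + y * x) = 1 := by
  rw [← Ideal.jacobson_bot, Ideal.mem_jacobson_iff]
  refine forall_congr' fun y => exists_congr fun z => ?_
  rw [Submodule.mem_bot, sub_eq_zero, mul_add, mul_one, ← mul_assoc, add_comm]

variable [IsLocalRing R]

theorem eq_zero_or_eq_one_of_isIdempotentElem {e : R} (he : IsIdempotentElem e) :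
    e = 0 ∨ e = 1 := by
  rcases IsLocalRing.isUnit_or_isUnit_of_add_one (sub_add_cancel 1 e) with hu | hu
  · exact Or.inl (sub_eq_self.1 ((IsIdempotentElem.iff_eq_one_of_isUnit hu).1 he.one_sub))
  · exact Or.inr ((IsIdempotentElem.iff_eq_one_of_isUnit hu).1 he)

instance : IsDedekindFiniteMonoid R where
  mul_eq_one_symm {a b} hab := by
    have hba : IsIdempotentElem (b * a) := by
      rw [IsIdempotentElem, mul_assoc, ← mul_assoc a, hab, one_mul]
    refine (eq_zero_or_eq_one_of_isIdempotentElem hba).resolve_left fun h0 => ?_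
    refine one_ne_zero (α := R) ?_
    calc (1 : R) = a * (b * a) * b := by rw [mul_assoc, mul_assoc, hab, mul_one, hab]
      _ = 0 := by rw [h0, mul_zero, zero_mul]

theorem isUnit_one_add_of_not_isUnit {a : R} (ha : ¬ IsUnit a) : IsUnit (1 + a) :=
  (IsLocalRing.isUnit_or_isUnit_of_add_one (add_neg_cancel_right 1 a)).resolve_right
    fun h => ha (IsUnit.neg_iff a |>.1 h)

theorem mem_ringJacobson_iff_not_isUnit {a : R} : a ∈ Ring.jacobson R ↔ ¬ IsUnit a := by
  refine ⟨fun ha hu => (Ring.jacobson_lt_top R).ne (Ideal.eq_top_of_isUnit_mem _ ha hu),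
    fun ha => mem_ringJacobson_iff.2 fun y => ?_⟩
  exact (isUnit_one_add_of_not_isUnit fun h => ha (isUnit_of_mul_isUnit_right h)).exists_left_inv

noncomputable instance : DivisionRing (R ⧸ Ring.jacobson R) :=
  have := Ideal.Quotient.nontrivial_iff.2 (Ring.jacobson_lt_top R).ne
  DivisionRing.ofIsUnitOrEqZero <| Ideal.Quotient.mk_surjective.forall.2 fun a =>
    (em (IsUnit a)).imp (fun ha => ha.map (Ideal.Quotient.mk _)) fun ha =>
      Ideal.Quotient.eq_zero_iff_mem.2 (mem_ringJacobson_iff_not_isUnit.2 ha)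

end LocalRing

section Retracts

variable {C : Type u} [Category.{v} C] {X Y : C}

theorem not_isIso_comp_of_isEmpty_retract (hXY : IsEmpty (Retract X Y)) (f : X ⟶ Y) (g : Y ⟶ X) :
    ¬ IsIso (f ≫ g) := fun _ =>
  hXY.false ⟨f, g ≫ inv (f ≫ g), by rw [← Category.assoc, IsIso.hom_inv_id]⟩

variable [Preadditive C]

theorem not_isZero_of_isLocalRing_end (X : C) [IsLocalRing (End X)] : ¬ IsZero X := fun h =>
  one_ne_zero (α := End X) (h.eq_of_src _ _)

theorem isLocalRing_end_of_iso (e : X ≅ Y) [IsLocalRing (End X)] : IsLocalRing (End Y) :=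
  let conj : End Y ≃+* End X :=
    { e.symm.conj with
      map_add' := fun (f g : Y ⟶ Y) =>
        show e.hom ≫ (f + g) ≫ e.inv = e.hom ≫ f ≫ e.inv + e.hom ≫ g ≫ e.inv by
          rw [Preadditive.add_comp, Preadditive.comp_add] }
  RingHom.domain_isLocalRing (conj : End Y →+* End X)

theorem nonempty_iso_of_retract [IsLocalRing (End Y)] (hX : ¬ IsZero X) (r : Retract X Y) :
    Nonempty (X ≅ Y) := by
  have he : IsIdempotentElem (End.of (r.r ≫ r.i)) :=
    show (r.r ≫ r.i) ≫ r.r ≫ r.i = r.r ≫ r.i by simp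
  rcases eq_zero_or_eq_one_of_isIdempotentElem he with h0 | h1
  · refine absurd ((IsZero.iff_id_eq_zero X).2 ?_) hX
    calc 𝟙 X = r.i ≫ (r.r ≫ r.i) ≫ r.r := by simp
      _ = r.i ≫ 0 ≫ r.r := congrArg (fun e => r.i ≫ e ≫ r.r) h0
      _ = 0 := by simp
  · exact ⟨⟨r.i, r.r, r.retract, h1⟩⟩

theorem comp_mem_ringJacobson [IsLocalRing (End X)] (hXY : IsEmpty (Retract X Y))
    (p : Y ⟶ X) (q : X ⟶ Y) : End.of (p ≫ q) ∈ Ring.jacobson (End Y) := by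
  refine mem_ringJacobson_iff.2 fun y => ?_
  have hu : IsUnit (1 + End.of ((q ≫ y) ≫ p)) := isUnit_one_add_of_not_isUnit fun h =>
    not_isIso_comp_of_isEmpty_retract hXY q (y ≫ p) (by simpa using (isUnit_iff_isIso _).1 h)
  obtain ⟨t : X ⟶ X, ht : (𝟙 X + (q ≫ y) ≫ p) ≫ t = 𝟙 X⟩ := hu.exists_left_inv
  -- If `t` inverts `1 + a b` then `1 - b t a` inverts `1 + b a`.
  refine ⟨End.of (𝟙 Y - p ≫ t ≫ q ≫ y), ?_⟩
  change (𝟙 Y + (p ≫ q) ≫ y) ≫ (𝟙 Y - p ≫ t ≫ q ≫ y) = 𝟙 Y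
  calc (𝟙 Y + (p ≫ q) ≫ y) ≫ (𝟙 Y - p ≫ t ≫ q ≫ y)
      = 𝟙 Y + p ≫ (𝟙 X - (𝟙 X + (q ≫ y) ≫ p) ≫ t) ≫ q ≫ y := by
        simp only [Preadditive.add_comp, Preadditive.comp_sub, Preadditive.sub_comp,
          Preadditive.comp_add, Category.id_comp, Category.comp_id, Category.assoc]
        abel
    _ = 𝟙 Y := by rw [ht, sub_self, zero_comp, comp_zero, add_zero]

theorem eq_zero_of_comp_eq_self {s : Y ⟶ Y} (hs : End.of s ∈ Ring.jacobson (End Y)) {x : X ⟶ Y}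
    (hx : x ≫ s = x) : x = 0 := by
  obtain ⟨z : Y ⟶ Y, hz⟩ := mem_ringJacobson_iff.1 hs (-1)
  rw [neg_one_mul] at hz
  change (𝟙 Y + -s) ≫ z = 𝟙 Y at hz
  calc x = x ≫ (𝟙 Y + -s) ≫ z := by rw [hz, Category.comp_id]
    _ = (x - x ≫ s) ≫ z := by
      rw [← Category.assoc, Preadditive.comp_add, Preadditive.comp_neg, Category.comp_id,
        sub_eq_add_neg]
    _ = 0 := by rw [hx, sub_self, zero_comp]

end Retracts

section Coproducts

variable {C : Type u} [Category.{v} C] [Preadditive C] [HasCoproducts.{w} C]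

open Classical in
theorem partialSum_eq_sum {I : Type w} (A : I → C) (F : Finset I) :
    partialSum A F = ∑ i ∈ F, partialSum A F ≫ Sigma.π A i ≫ Sigma.ι A i :=
  Sigma.hom_ext _ _ fun j => by
    rw [Preadditive.comp_sum, Finset.sum_eq_single_of_mem j.1 j.2]
    · simp [partialSum]
    · intro i _ hi
      simp [partialSum, Sigma.ι_π_of_ne_assoc A hi.symm]

open Classical in
theorem IsCompactObject.exists_eq_sum {K : C} (hK : IsCompactObject.{w} K) {I : Type w}
    (A : I → C) (f : K ⟶ ∐ A) :
    ∃ F : Finset I, f = ∑ i ∈ F, f ≫ Sigma.π A i ≫ Sigma.ι A i := by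
  obtain ⟨F, g, rfl⟩ := hK I A f
  refine ⟨F, ?_⟩
  conv_lhs => rw [partialSum_eq_sum, Preadditive.comp_sum]
  simp only [Category.assoc]

theorem exists_nonempty_retract_of_retract_coproduct (hC : HasEnoughCompacts.{w} C) {I : Type w}
    {A : I → C} [∀ i, IsLocalRing (End (A i))] {B : C} (hB : ¬ IsZero B) (r : Retract B (∐ A)) :
    ∃ i, Nonempty (Retract (A i) B) := by
  classical
  by_contra! h
  obtain ⟨K, x, hK, hx⟩ := hC B hB
  obtain ⟨F, hF⟩ := hK.exists_eq_sum A (x ≫ r.i)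
  let s : B ⟶ B := ∑ i ∈ F, (r.i ≫ Sigma.π A i) ≫ Sigma.ι A i ≫ r.r
  have hs : End.of s ∈ Ring.jacobson (End B) :=
    Ideal.sum_mem _ fun i _ => comp_mem_ringJacobson (h i) _ _
  refine hx (eq_zero_of_comp_eq_self hs ?_)
  calc x ≫ s = (∑ i ∈ F, (x ≫ r.i) ≫ Sigma.π A i ≫ Sigma.ι A i) ≫ r.r := by
        simp only [s, Preadditive.comp_sum, Preadditive.sum_comp, Category.assoc]
    _ = x := by rw [← hF, Category.assoc, r.retract, Category.comp_id]

end Coproducts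

section WeaklyIdempotentComplete

/-- A category is weakly idempotent complete if every split monomorphism has a cokernel. In a
preadditive category this says that every retract of an object is a direct summand of it. -/
class IsWeaklyIdempotentComplete (C : Type u) [Category.{v} C] [HasZeroMorphisms C] : Prop where
  hasCokernel_of_isSplitMono {X Y : C} (f : X ⟶ Y) [IsSplitMono f] : HasCokernel f

open Pretriangulated in
instance {C : Type u} [Category.{v} C] [Preadditive C] [HasZeroObject C] [HasShift C ℤ]
    [∀ n : ℤ, (shiftFunctor C n).Additive] [Pretriangulated C] : IsWeaklyIdempotentComplete C where
  hasCokernel_of_isSplitMono {X Y} f _ := by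
    obtain ⟨Z, g, δ, hT⟩ := distinguished_cocone_triangle f
    have : Epi g :=
      Triangle.epi₂ _ hT (Triangle.mor₃_eq_zero_of_mono₁ _ hT (inferInstanceAs (Mono f)))
    choose desc hdesc using fun {W : C} (k : Y ⟶ W) (hk : f ≫ k = 0) =>
      Triangle.yoneda_exact₂ _ hT k hk
    exact ⟨⟨_, CokernelCofork.IsColimit.ofπ g (comp_distTriang_mor_zero₁₂ _ hT) desc
      (fun k hk => (hdesc k hk).symm)
      (fun k hk m hm => (cancel_epi g).1 (hm.trans (hdesc k hk)))⟩⟩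

variable {C : Type u} [Category.{v} C] [Preadditive C] [HasBinaryBiproducts C]

theorem nonempty_iso_of_retract_of_indecomposable [IsWeaklyIdempotentComplete C] {X Y : C}
    (hX : ¬ IsZero X) (hY : Indecomposable Y) (r : Retract X Y) : Nonempty (X ≅ Y) := by
  have := IsWeaklyIdempotentComplete.hasCokernel_of_isSplitMono r.i
  have e : Y ≅ X ⊞ cokernel r.i := biprod.uniqueUpToIso _ _
    (isBilimitBinaryBiconeOfIsSplitMonoOfCokernel (cokernelIsCokernel r.i))
  have hcoker : IsZero (cokernel r.i) := (hY.2 _ _ e).resolve_left hX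
  have : Epi r.i := Preadditive.epi_of_cokernel_zero (hcoker.eq_of_tgt _ _)
  have := isIso_of_epi_of_isSplitMono r.i
  exact ⟨asIso r.i⟩

theorem exists_iso_of_retract_coproduct [IsWeaklyIdempotentComplete C] [HasCoproducts.{w} C]
    (hC : HasEnoughCompacts.{w} C) {I : Type w} {A : I → C} [∀ i, IsLocalRing (End (A i))] {B : C}
    (hB : Indecomposable B) (r : Retract B (∐ A)) : ∃ i, Nonempty (A i ≅ B) :=
  (exists_nonempty_retract_of_retract_coproduct hC hB.1 r).imp fun _ ⟨r'⟩ =>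
    nonempty_iso_of_retract_of_indecomposable (not_isZero_of_isLocalRing_end _) hB r'

end WeaklyIdempotentComplete

section Residue

variable {C : Type u} [Category.{v} C] [Preadditive C]

/-- The residue division ring of an object `X` with local endomorphism ring. The opposite is taken
because multiplication in `End X` is composition in the reverse of the diagrammatic order. -/
abbrev ResidueRing (X : C) : Type v := (End X ⧸ Ring.jacobson (End X))ᵐᵒᵖ

/-- The class of an endomorphism of `X` in the residue division ring. -/
noncomputable def residue (X : C) : (X ⟶ X) →+ ResidueRing X where
  toFun f := MulOpposite.op (Ideal.Quotient.mk _ (End.of f))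
  map_zero' := rfl
  map_add' _ _ := rfl

theorem residue_id (X : C) : residue X (𝟙 X) = 1 := rfl

theorem residue_comp {X : C} (f g : X ⟶ X) : residue X (f ≫ g) = residue X f * residue X g := rfl

theorem residue_eq_zero_iff {X : C} [IsLocalRing (End X)] {f : X ⟶ X} :
    residue X f = 0 ↔ ¬ IsIso f := by
  rw [← isUnit_iff_isIso, ← mem_ringJacobson_iff_not_isUnit, ← Ideal.Quotient.eq_zero_iff_mem]
  exact MulOpposite.op_eq_zero_iff (Ideal.Quotient.mk _ (End.of f))

/-- The residues of all composites `X ⟶ Y ⟶ X` with first factor `f`. For `End X` local, the kernel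
of this map consists of the morphisms `X ⟶ Y` that are not split monomorphisms. -/
noncomputable def residueVector (X Y : C) : (X ⟶ Y) →+ ((Y ⟶ X) → ResidueRing X) where
  toFun f g := residue X (f ≫ g)
  map_zero' := by ext g; simp
  map_add' f f' := by ext g; simp [Preadditive.add_comp]

/-- The left `ResidueRing X`-module of morphisms `X ⟶ Y` modulo those that are not split
monomorphisms, realised inside a space of functions. Its dimension is the multiplicity of `X` as a
direct summand of `Y`. -/
noncomputable def residueSpace (X Y : C) :
    Submodule (ResidueRing X) ((Y ⟶ X) → ResidueRing X) :=
  Submodule.span _ (Set.range (residueVector X Y))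

theorem residueVector_apply {X Y : C} (f : X ⟶ Y) (g : Y ⟶ X) :
    residueVector X Y f g = residue X (f ≫ g) := rfl

theorem residueVector_comp {X Y : C} (e : X ⟶ X) (f : X ⟶ Y) :
    residueVector X Y (e ≫ f) = residue X e • residueVector X Y f := by
  ext g
  rw [residueVector_apply, Category.assoc, residue_comp, Pi.smul_apply, smul_eq_mul,
    residueVector_apply]

theorem residueVector_eq_zero_iff {X Y : C} [IsLocalRing (End X)] {f : X ⟶ Y} :
    residueVector X Y f = 0 ↔ ¬ IsSplitMono f := by
  rw [funext_iff]
  refine ⟨fun h _ => residue_eq_zero_iff.1 (h (retraction f)) ?_,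
    fun hf g => residue_eq_zero_iff.2 fun _ => hf ?_⟩
  · rw [IsSplitMono.id]
    infer_instance
  · exact ⟨⟨g ≫ inv (f ≫ g), by rw [← Category.assoc, IsIso.hom_inv_id]⟩⟩

theorem residueVector_comp_eq_zero {X Y Z : C} [IsLocalRing (End X)] (hXZ : IsEmpty (Retract X Z))
    (p : X ⟶ Z) (q : Z ⟶ Y) : residueVector X Y (p ≫ q) = 0 := by
  ext g
  rw [residueVector_apply, Category.assoc]
  exact residue_eq_zero_iff.2 (not_isIso_comp_of_isEmpty_retract hXZ p (q ≫ g))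

end Residue

section Multiplicity

variable {C : Type u} [Category.{v} C] [Preadditive C] [HasCoproducts.{w} C]

open Classical in
theorem exists_residueVector_eq_sum (hC : HasEnoughCompacts.{w} C) {X Y : C} [IsLocalRing (End X)]
    {I : Type w} {A : I → C} (φ : ∐ A ≅ Y) (f : X ⟶ Y) :
    ∃ F : Finset I, residueVector X Y f =
      ∑ i ∈ F, residueVector X Y ((f ≫ φ.inv ≫ Sigma.π A i) ≫ Sigma.ι A i ≫ φ.hom) := by
  obtain ⟨K, x, hK, hx⟩ := hC X (not_isZero_of_isLocalRing_end X)
  obtain ⟨F, hF⟩ := hK.exists_eq_sum A (x ≫ f ≫ φ.inv)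
  refine ⟨F, ?_⟩
  rw [← map_sum, ← sub_eq_zero, ← map_sub, residueVector_eq_zero_iff]
  let d := f - ∑ i ∈ F, (f ≫ φ.inv ≫ Sigma.π A i) ≫ Sigma.ι A i ≫ φ.hom
  have hxd : x ≫ d = 0 := by
    have hxf := congrArg (· ≫ φ.hom) hF
    simp only [Preadditive.sum_comp, Category.assoc, Iso.inv_hom_id, Category.comp_id] at hxf
    simpa only [d, Preadditive.comp_sub, Preadditive.comp_sum, Category.assoc, sub_eq_zero]
      using hxf
  exact fun _ : IsSplitMono d => hx (zero_of_comp_mono d hxd)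

/-- The residue vector of the inclusion of the `i`-th summand of `Y`, transported along a chosen
isomorphism between `X` and that summand. -/
noncomputable def summandVector (X : C) {Y : C} {I : Type w} {A : I → C} (φ : ∐ A ≅ Y)
    (i : {i : I // Nonempty (X ≅ A i)}) : (Y ⟶ X) → ResidueRing X :=
  residueVector X Y (i.2.some.hom ≫ Sigma.ι A i ≫ φ.hom)

theorem linearIndependent_summandVector (X : C) {Y : C} {I : Type w} {A : I → C} (φ : ∐ A ≅ Y) :
    LinearIndependent (ResidueRing X) (summandVector X φ) := by
  classical
  let evalProj (i : {i // Nonempty (X ≅ A i)}) :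
      Module.Dual (ResidueRing X) ((Y ⟶ X) → ResidueRing X) :=
    LinearMap.proj (φ.inv ≫ Sigma.π A i ≫ i.2.some.inv)
  refine LinearIndependent.of_pairwise_dual_eq_zero_one _ evalProj ?_ ?_
  · intro i j hij
    have hij' : (i : I) ≠ j := Subtype.coe_injective.ne hij
    simp [evalProj, summandVector, residueVector_apply, Sigma.ι_π_of_ne_assoc A hij'.symm]
  · intro i
    simp [evalProj, summandVector, residueVector_apply, residue_id]

theorem span_range_summandVector (hC : HasEnoughCompacts.{w} C) {X Y : C} [IsLocalRing (End X)]
    {I : Type w} {A : I → C} [∀ i, IsLocalRing (End (A i))] (φ : ∐ A ≅ Y) :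
    Submodule.span (ResidueRing X) (Set.range (summandVector X φ)) = residueSpace X Y := by
  refine le_antisymm (Submodule.span_mono (Set.range_subset_iff.2 fun i => ⟨_, rfl⟩))
    (Submodule.span_le.2 (Set.range_subset_iff.2 fun f => ?_))
  classical
  obtain ⟨F, hF⟩ := exists_residueVector_eq_sum hC φ f
  rw [hF]
  refine Submodule.sum_mem _ fun i _ => ?_
  by_cases hi : Nonempty (X ≅ A i)
  · have hfactor : (f ≫ φ.inv ≫ Sigma.π A i) ≫ Sigma.ι A i ≫ φ.hom =
        (f ≫ φ.inv ≫ Sigma.π A i ≫ hi.some.inv) ≫ hi.some.hom ≫ Sigma.ι A i ≫ φ.hom := by simp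
    rw [hfactor, residueVector_comp]
    exact Submodule.smul_mem _ _ (Submodule.subset_span ⟨⟨i, hi⟩, rfl⟩)
  · have hXA : IsEmpty (Retract X (A i)) :=
      ⟨fun r => hi (nonempty_iso_of_retract (not_isZero_of_isLocalRing_end X) r)⟩
    rw [residueVector_comp_eq_zero hXA]
    exact Submodule.zero_mem _

/-- The summands of `∐ A ≅ Y` isomorphic to `X` give a basis of `residueSpace X Y`. -/
noncomputable def summandBasis (hC : HasEnoughCompacts.{w} C) {X Y : C} [IsLocalRing (End X)]
    {I : Type w} {A : I → C} [∀ i, IsLocalRing (End (A i))] (φ : ∐ A ≅ Y) :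
    Module.Basis {i // Nonempty (X ≅ A i)} (ResidueRing X) (residueSpace X Y) :=
  (Module.Basis.span (linearIndependent_summandVector X φ)).map
    (LinearEquiv.ofEq _ _ (span_range_summandVector hC φ))

theorem nonempty_equiv_of_coproduct_iso (hC : HasEnoughCompacts.{w} C) (X : C)
    {I J : Type w} {A : I → C} {B : J → C} [∀ i, IsLocalRing (End (A i))]
    [∀ j, IsLocalRing (End (B j))] (φ : ∐ A ≅ ∐ B) :
    Nonempty ({i // Nonempty (X ≅ A i)} ≃ {j // Nonempty (X ≅ B j)}) := by
  by_cases hX : IsLocalRing (End X)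
  · exact ⟨(summandBasis hC φ).indexEquiv (summandBasis hC (Iso.refl (∐ B)))⟩
  · have hA : IsEmpty {i // Nonempty (X ≅ A i)} :=
      ⟨fun ⟨_, ⟨e⟩⟩ => hX (isLocalRing_end_of_iso e.symm)⟩
    have hB : IsEmpty {j // Nonempty (X ≅ B j)} :=
      ⟨fun ⟨_, ⟨e⟩⟩ => hX (isLocalRing_end_of_iso e.symm)⟩
    exact ⟨Equiv.equivOfIsEmpty _ _⟩

theorem exists_equiv_of_coproduct_iso (hC : HasEnoughCompacts.{w} C)
    {I J : Type w} {A : I → C} {B : J → C} [∀ i, IsLocalRing (End (A i))]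
    [∀ j, IsLocalRing (End (B j))] (φ : ∐ A ≅ ∐ B) :
    ∃ σ : I ≃ J, ∀ i, Nonempty (A i ≅ B (σ i)) := by
  let isoClass : C → Quotient (isIsomorphicSetoid C) := Quotient.mk _
  have hfiber (c : Quotient (isIsomorphicSetoid C)) :
      Nonempty ({i // isoClass (A i) = c} ≃ {j // isoClass (B j) = c}) := by
    induction c using Quotient.inductionOn with | h X =>
    have hclass (Y : C) : isoClass Y = isoClass X ↔ Nonempty (X ≅ Y) :=
      Quotient.eq.trans ⟨fun ⟨e⟩ => ⟨e.symm⟩, fun ⟨e⟩ => ⟨e.symm⟩⟩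
    obtain ⟨e⟩ := nonempty_equiv_of_coproduct_iso hC X φ
    exact ⟨(Equiv.subtypeEquivRight fun i => hclass (A i)).trans
      (e.trans (Equiv.subtypeEquivRight fun j => hclass (B j)).symm)⟩
  let σ : I ≃ J := Equiv.ofFiberEquiv fun c => (hfiber c).some
  have hσ (i : I) : isoClass (B (σ i)) = isoClass (A i) :=
    Equiv.ofFiberEquiv_map (fun c => (hfiber c).some) i
  exact ⟨σ, fun i => Quotient.exact (hσ i).symm⟩

end Multiplicity

end KRSA

theorem corollary4p2_general {C : Type u} [Category.{v} C] [Preadditive C]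
    [HasBinaryBiproducts C] [KRSA.IsWeaklyIdempotentComplete C] [HasCoproducts.{w} C]
    (hC : KRSA.HasEnoughCompacts.{w} C)
    {I : Type w} (A : I → C) (hA : ∀ i, IsLocalRing (End (A i))) :
    (∀ B : C, Indecomposable B → KRSA.IsDirectSummand B (∐ A) →
      ∃ i, Nonempty (B ≅ A i)) ∧
    (∀ (J : Type w) (B : J → C), (∀ j, Indecomposable (B j)) → Nonempty ((∐ A) ≅ ∐ B) →
      ∃ σ : I ≃ J, ∀ i, Nonempty (A i ≅ B (σ i))) := by
  classical
  constructor
  · rintro B hB ⟨B', ⟨e⟩⟩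
    let r : Retract B (∐ A) := { i := biprod.inl ≫ e.inv, r := e.hom ≫ biprod.fst }
    obtain ⟨i, ⟨eA⟩⟩ := KRSA.exists_iso_of_retract_coproduct hC hB r
    exact ⟨i, ⟨eA.symm⟩⟩
  · rintro J B hB ⟨φ⟩
    have hBlocal (j : J) : IsLocalRing (End (B j)) := by
      let r : Retract (B j) (∐ A) := { i := Sigma.ι B j ≫ φ.inv, r := φ.hom ≫ Sigma.π B j }
      obtain ⟨i, ⟨eA⟩⟩ := KRSA.exists_iso_of_retract_coproduct hC (hB j) r
      exact KRSA.isLocalRing_end_of_iso eA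
    exact KRSA.exists_equiv_of_coproduct_iso hC φ

theorem corollary4p2 {C : Type u} [Category.{v} C] [Preadditive C] [HasZeroObject C]
    [HasShift C ℤ] [∀ n : ℤ, (shiftFunctor C n).Additive] [Pretriangulated C] [IsTriangulated C]
    [HasCoproducts.{w} C] (hC : KRSA.IsCompactlyGenerated.{w} C)
    {I : Type w} (A : I → C) (hA : ∀ i, IsLocalRing (End (A i))) :
    (∀ B : C, Indecomposable B → KRSA.IsDirectSummand B (∐ A) →
      ∃ i, Nonempty (B ≅ A i)) ∧
    (∀ (J : Type w) (B : J → C), (∀ j, Indecomposable (B j)) → Nonempty ((∐ A) ≅ ∐ B) →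
      ∃ σ : I ≃ J, ∀ i, Nonempty (A i ≅ B (σ i))) := by
  exact corollary4p2_general hC.enough A hA
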